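/- Let $\mathbb D=\{z\in\mathbb C:|z|<1\}$, let $\ell^\infty$ be the Banach space of bounded complex sequences with the sup norm, and let $B:\ell^\infty\to\ell^\infty$, $B(x_1,x_2,x_3,\dots)=(x_2,x_3,\dots)$, be the (unweighted) backward shift. For a bounded linear operator $T$ on a complex Banach space $X$ and $x\in X$, let $J_T(x)$ be the set of all $y\in X$ for which there are a strictly increasing sequence $(k_n)$ of natural numbers and a sequence $(x_n)$ in $X$ with $x_n\to x$ and $T^{k_n}x_n\to y$; $T$ is called $J$-class if $J_T(x)=X$ for some $x\in X\setminus\{0\}$. Let $f$ be a holomorphic function on an open neighborhood of the closed unit disc $\overline{\mathbb D}$, with Taylor expansion $f(z)=\sum_{n\ge 0}a_nz^n$ at $0$, and let $f(B)=\sum_{n\ge 0}a_nB^n$ (convergent in operator norm). Then the following statements are equivalent. (i) $f(B)$ is $J$-class. (ii) $f(\partial\mathbb D)\cap\overline{\mathbb D}=\emptyset$ and $\overline{\mathbb D}\subseteq f(\mathbb D)$. -/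

import Mathlib

open scoped ENNReal

/-- The complex Banach space of bounded complex sequences with the sup norm. -/
abbrev LInf : Type := lp (fun _ : ℕ => ℂ) ∞

theorem memℓp_shift (x : LInf) : Memℓp (fun n => x (n + 1)) ∞ := by
  refine memℓp_infty ⟨‖x‖, ?_⟩
  rintro _ ⟨n, rfl⟩
  exact lp.norm_apply_le_norm ENNReal.top_ne_zero x (n + 1)

/-- The unweighted backward shift `(x₀, x₁, x₂, …) ↦ (x₁, x₂, x₃, …)` on bounded sequences. -/
noncomputable def backwardShift : LInf →L[ℂ] LInf :=
  LinearMap.mkContinuous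
    { toFun := fun x => (⟨fun n => x (n + 1), memℓp_shift x⟩ : LInf)
      map_add' := fun _ _ => rfl
      map_smul' := fun _ _ => rfl }
    1
    (fun x => by
      rw [one_mul]
      exact lp.norm_le_of_forall_le (norm_nonneg x)
        (fun n => lp.norm_apply_le_norm ENNReal.top_ne_zero x (n + 1)))

theorem backwardShift_apply (x : LInf) (n : ℕ) : backwardShift x n = x (n + 1) := rfl

/-- `f(T) = ∑ aₙ Tⁿ` in operator norm, where `aₙ = f⁽ⁿ⁾(0) / n!` are the Taylor coefficients of `f`
at `0`. This is the holomorphic functional calculus when `f` is holomorphic on a neighbourhood of a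
closed disc centred at `0` whose radius is at least the spectral radius of `T`. -/
noncomputable def holoCalc {X : Type*} [NormedAddCommGroup X] [NormedSpace ℂ X]
    (f : ℂ → ℂ) (T : X →L[ℂ] X) : X →L[ℂ] X :=
  ∑' n : ℕ, (iteratedDeriv n f 0 / (n.factorial : ℂ)) • T ^ n

/-- The series defining `f(B)` converges in operator norm (so `holoCalc` takes no default value)
whenever `f` is holomorphic on a neighbourhood of the closed unit disc. -/
theorem hasSum_holoCalc_backwardShift (f : ℂ → ℂ) (U : Set ℂ) (hU : IsOpen U)
    (hDU : Metric.closedBall (0 : ℂ) 1 ⊆ U) (hf : DifferentiableOn ℂ f U) :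
    HasSum (fun n : ℕ => (iteratedDeriv n f 0 / (n.factorial : ℂ)) • backwardShift ^ n)
      (holoCalc f backwardShift) := by
  obtain ⟨δ, hδ, hsub⟩ := (isCompact_closedBall (0 : ℂ) 1).exists_thickening_subset_open hU hDU
  rw [thickening_closedBall hδ zero_le_one] at hsub
  have hz : ((1 + δ / 2 : ℝ) : ℂ) ∈ Metric.ball (0 : ℂ) (δ + 1) := by
    rw [mem_ball_zero_iff, Complex.norm_real, Real.norm_of_nonneg (by positivity)]
    linarith
  have hs := (Complex.hasSum_taylorSeries_on_ball (hf.mono hsub) hz).summable.norm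
  have hB : ‖backwardShift‖ ≤ 1 := LinearMap.mkContinuous_norm_le _ zero_le_one _
  have hBn : ∀ n : ℕ, ‖backwardShift ^ n‖ ≤ 1 := by
    intro n
    induction n with
    | zero => exact ContinuousLinearMap.norm_id_le
    | succ k ih =>
      rw [pow_succ]
      exact (norm_mul_le _ _).trans (mul_le_one₀ ih (norm_nonneg _) hB)
  refine (Summable.of_norm_bounded hs fun n => ?_).hasSum
  have h1 : (1 : ℝ) ≤ ‖((1 + δ / 2 : ℝ) : ℂ) ^ n‖ := by
    rw [norm_pow, Complex.norm_real, Real.norm_of_nonneg (by positivity)]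
    exact one_le_pow₀ (by linarith)
  have h2 := (hBn n).trans h1
  rw [norm_smul, sub_zero, norm_smul, norm_smul, div_eq_inv_mul, norm_mul, mul_assoc]
  refine mul_le_mul_of_nonneg_left ?_ (norm_nonneg _)
  rw [mul_comm]
  exact mul_le_mul_of_nonneg_right h2 (norm_nonneg _)

/-- The `J`-set of `x` under `T`: all `y` such that `T ^ (k n) (x n) → y` for some strictly
increasing sequence `k` of natural numbers and some sequence of vectors converging to `x`. -/
def JSet {X : Type*} [NormedAddCommGroup X] [NormedSpace ℂ X] (T : X →L[ℂ] X) (x : X) : Set X :=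
  {y | ∃ (k : ℕ → ℕ) (u : ℕ → X), StrictMono k ∧
    Filter.Tendsto u Filter.atTop (nhds x) ∧
    Filter.Tendsto (fun n => (T ^ k n) (u n)) Filter.atTop (nhds y)}

/-- `T` is a `J`-class operator if the `J`-set of some nonzero vector is the whole space. -/
def IsJClass {X : Type*} [NormedAddCommGroup X] [NormedSpace ℂ X] (T : X →L[ℂ] X) : Prop :=
  ∃ x : X, x ≠ 0 ∧ JSet T x = Set.univ

/-! ### Spectra of power series in a Banach algebra -/

section SpectralMapping

/-! Necessity: for `|w| = 1` the sequence `(wⁿ)` is not in the closure of the range of `B - w`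
(`half_le_norm_sub_powSeq`), so `B` acts as the scalar `w`, and `f(B)` as `f w`, on a nonzero
quotient; `IsJClass.one_lt_norm_of_intertwine` then forces `1 < |f w|`. If moreover `|f| > 1` on the
whole closed disc, `f(B)` is invertible with inverse powers tending to zero, which excludes
`J`-class. So `f` takes some value in the closed disc, and openness with connectedness gives them
all.

Sufficiency: a zero `w` of `f` in the disc puts `(wⁿ)` in the kernel of `f(B)`. The bilateral shift
has spectrum in the circle, so `f` of it is invertible with inverse powers tending to zero;
compressing these to the nonnegative indices gives right inverses of the powers of `f(B)`. -/

theorem exists_mem_spectrum_hasSum_of_comm {A : Type*} [NormedCommRing A] [NormedAlgebra ℂ A]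
    [CompleteSpace A] {a b : A} {c : ℕ → ℂ} (h : HasSum (fun n => c n • a ^ n) b) {z : ℂ}
    (hz : z ∈ spectrum ℂ b) : ∃ w ∈ spectrum ℂ a, HasSum (fun n => c n * w ^ n) z := by
  obtain ⟨χ, rfl⟩ := WeakDual.CharacterSpace.mem_spectrum_iff_exists.1 hz
  refine ⟨χ a, AlgHom.apply_mem_spectrum χ a, ?_⟩
  have := h.map χ (map_continuous χ)
  simpa [Function.comp_def] using this

/-- One half of the spectral mapping theorem for power series in a Banach algebra. -/
theorem exists_mem_spectrum_hasSum {A : Type*} [NormedRing A] [NormedAlgebra ℂ A]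
    [CompleteSpace A] {a b : A} {c : ℕ → ℂ} (h : HasSum (fun n => c n • a ^ n) b) {z : ℂ}
    (hz : z ∈ spectrum ℂ b) : ∃ w ∈ spectrum ℂ a, HasSum (fun n => c n * w ^ n) z := by
  -- The double centralizer of `a` is commutative and closed, so it contains `b`.
  let C : Subalgebra ℂ A := Subalgebra.centralizer ℂ (Set.centralizer {a})
  have haC : a ∈ C := by
    rw [Subalgebra.mem_centralizer_iff]
    intro g hg
    exact (hg a rfl).symm
  have hcomm : ∀ x ∈ C, ∀ y ∈ C, x * y = y * x := by
    intro x hx y hy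
    refine (Subalgebra.mem_centralizer_iff ℂ).1 hy x ?_
    rintro _ rfl
    exact hx _ fun m hm => by rw [Set.mem_singleton_iff.1 hm]
  have hclosed : IsClosed (C : Set A) := Set.isClosed_centralizer _
  have hbC : b ∈ C := hclosed.mem_of_tendsto h
    (Filter.Eventually.of_forall fun s => C.sum_mem fun n _ => C.smul_mem (C.pow_mem haC n) _)
  have : CompleteSpace C := hclosed.completeSpace_coe
  let _ : NormedCommRing C :=
    { (inferInstance : NormedRing C) with
      mul_comm := fun x y => Subtype.ext (hcomm x x.2 y y.2) }
  have h' : HasSum (fun n => c n • (⟨a, haC⟩ : C) ^ n) ⟨b, hbC⟩ := by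
    refine (Topology.IsInducing.hasSum_iff (g := C.val) Topology.IsInducing.subtypeVal _ _).1 ?_
    exact h
  have hz' : z ∈ spectrum ℂ (⟨b, hbC⟩ : C) := spectrum.subset_subalgebra (⟨b, hbC⟩ : C) hz
  obtain ⟨w, hw, hs⟩ := exists_mem_spectrum_hasSum_of_comm h' hz'
  -- A double centralizer is closed under inverses, so the spectrum of `a` does not grow in `C`.
  refine ⟨w, fun hu => hw ?_, hs⟩
  obtain ⟨u, hu⟩ := (hu : IsUnit _)
  have hcu : ∀ g ∈ Set.centralizer {a}, g * (u : A) = u * g := by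
    intro g hg
    rw [hu, mul_sub, sub_mul, hg a rfl, Algebra.commutes]
  have hi : ((u⁻¹ : Aˣ) : A) ∈ C := by
    rw [Subalgebra.mem_centralizer_iff]
    intro g hg
    exact ((show Commute g u from hcu g hg).units_inv_right).eq
  refine IsUnit.of_mul_eq_one ⟨_, hi⟩ (Subtype.ext ?_)
  change (algebraMap ℂ A w - a) * ((u⁻¹ : Aˣ) : A) = 1
  rw [← hu, Units.mul_inv]

/-- An element whose spectrum misses the closed unit disc is invertible, and the powers of its
inverse tend to zero. -/
theorem exists_unit_inv_pow_tendsto_zero {A : Type*} [NormedRing A] [NormedAlgebra ℂ A]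
    [CompleteSpace A] {b : A} (h : ∀ z ∈ spectrum ℂ b, 1 < ‖z‖) :
    ∃ u : Aˣ, (u : A) = b ∧
      Filter.Tendsto (fun n : ℕ => ((u⁻¹ : Aˣ) : A) ^ n) Filter.atTop (nhds 0) := by
  cases subsingleton_or_nontrivial A
  · exact ⟨1, Subsingleton.elim _ _, by
      simpa only [Subsingleton.elim _ (0 : A)] using tendsto_const_nhds⟩
  have h0 : IsUnit b := by
    rw [← spectrum.zero_notMem_iff ℂ]
    intro h0
    have := h 0 h0
    norm_num at this
  obtain ⟨u, rfl⟩ := h0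
  refine ⟨u, rfl, ?_⟩
  have hr : spectralRadius ℂ ((u⁻¹ : Aˣ) : A) < (1 : NNReal) := by
    refine spectrum.spectralRadius_lt_of_forall_lt _ fun z hz => ?_
    have hz0 : z ≠ 0 := spectrum.ne_zero_of_mem_of_unit hz
    have := h _ ((spectrum.inv_mem_iff (r := (Units.mk0 z hz0))).1 hz)
    simp only [Units.val_inv_eq_inv_val, Units.val_mk0, norm_inv] at this
    rw [← NNReal.coe_lt_coe, coe_nnnorm, NNReal.coe_one]
    by_contra! h1
    exact absurd (inv_le_one_of_one_le₀ h1) (not_le.2 this)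
  -- Gelfand's formula gives geometric decay of the powers.
  obtain ⟨r, hr1, hr2⟩ := ENNReal.lt_iff_exists_nnreal_btwn.1 hr
  have hev := (spectrum.pow_nnnorm_pow_one_div_tendsto_nhds_spectralRadius
    ((u⁻¹ : Aˣ) : A)).eventually_lt_const hr1
  refine squeeze_zero_norm' (a := fun n => (r : ℝ) ^ n) ?_
    (tendsto_pow_atTop_nhds_zero_of_lt_one r.2 (by exact_mod_cast hr2))
  filter_upwards [hev, Filter.eventually_gt_atTop 0] with n hn hn0
  have h1 := ENNReal.rpow_le_rpow hn.le (z := n) (by positivity)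
  rw [← ENNReal.rpow_mul, one_div_mul_cancel (by positivity), ENNReal.rpow_one,
    ENNReal.rpow_natCast] at h1
  exact_mod_cast h1

end SpectralMapping

/-! ### Functional calculus of contractions -/

section TaylorSeries

variable {f : ℂ → ℂ} {U : Set ℂ}

theorem exists_ball_subset_of_closedBall_subset (hU : IsOpen U)
    (hDU : Metric.closedBall (0 : ℂ) 1 ⊆ U) : ∃ r : ℝ, 1 < r ∧ Metric.ball (0 : ℂ) r ⊆ U := by
  obtain ⟨δ, hδ, hsub⟩ := (isCompact_closedBall (0 : ℂ) 1).exists_thickening_subset_open hU hDU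
  rw [thickening_closedBall hδ zero_le_one] at hsub
  exact ⟨δ + 1, by linarith, hsub⟩

theorem hasSum_taylor_of_mem_closedBall (hU : IsOpen U)
    (hDU : Metric.closedBall (0 : ℂ) 1 ⊆ U) (hf : DifferentiableOn ℂ f U) {w : ℂ}
    (hw : w ∈ Metric.closedBall (0 : ℂ) 1) :
    HasSum (fun n : ℕ => iteratedDeriv n f 0 / (n.factorial : ℂ) * w ^ n) (f w) := by
  obtain ⟨r, hr, hsub⟩ := exists_ball_subset_of_closedBall_subset hU hDU
  have := Complex.hasSum_taylorSeries_on_ball (hf.mono hsub)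
    (Metric.closedBall_subset_ball hr hw)
  refine this.congr_fun fun n => ?_
  simp only [sub_zero, smul_eq_mul]
  ring

theorem hasSum_holoCalc {X : Type*} [NormedAddCommGroup X] [NormedSpace ℂ X] [CompleteSpace X]
    (hU : IsOpen U) (hDU : Metric.closedBall (0 : ℂ) 1 ⊆ U) (hf : DifferentiableOn ℂ f U)
    {T : X →L[ℂ] X} (hT : ‖T‖ ≤ 1) :
    HasSum (fun n : ℕ => (iteratedDeriv n f 0 / (n.factorial : ℂ)) • T ^ n) (holoCalc f T) := by
  have hs := (hasSum_taylor_of_mem_closedBall hU hDU hf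
    (w := 1) (by simp)).summable.norm
  refine (Summable.of_norm_bounded hs fun n => ?_).hasSum
  have hTn : ‖T ^ n‖ ≤ 1 := by
    induction n with
    | zero => exact ContinuousLinearMap.norm_id_le
    | succ k ih =>
      rw [pow_succ]
      exact (norm_mul_le _ _).trans (mul_le_one₀ ih (norm_nonneg _) hT)
  rw [norm_smul, one_pow, mul_one]
  exact mul_le_of_le_one_right (norm_nonneg _) hTn

/-- If `f` maps the spectrum of a contraction `T` outside the closed unit disc, then `f(T)` is
invertible, and the powers of its inverse tend to zero. -/
theorem exists_unit_holoCalc {X : Type*} [NormedAddCommGroup X] [NormedSpace ℂ X] [CompleteSpace X]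
    (hU : IsOpen U) (hDU : Metric.closedBall (0 : ℂ) 1 ⊆ U) (hf : DifferentiableOn ℂ f U)
    {T : X →L[ℂ] X} (hT : ‖T‖ ≤ 1) (h : ∀ w ∈ spectrum ℂ T, 1 < ‖f w‖) :
    ∃ u : (X →L[ℂ] X)ˣ, (u : X →L[ℂ] X) = holoCalc f T ∧
      Filter.Tendsto (fun n : ℕ => ((u⁻¹ : (X →L[ℂ] X)ˣ) : X →L[ℂ] X) ^ n)
        Filter.atTop (nhds 0) := by
  refine exists_unit_inv_pow_tendsto_zero fun z hz => ?_
  obtain ⟨w, hw, hs⟩ := exists_mem_spectrum_hasSum (hasSum_holoCalc hU hDU hf hT) hz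
  have hw1 : w ∈ Metric.closedBall (0 : ℂ) 1 := by
    rw [mem_closedBall_zero_iff]
    refine (spectrum.norm_le_norm_mul_of_mem hw).trans ?_
    exact mul_le_one₀ hT (norm_nonneg _) ContinuousLinearMap.norm_id_le
  rw [hs.unique (hasSum_taylor_of_mem_closedBall hU hDU hf hw1)]
  exact h w hw

/-- If `q` intertwines `T` and `S`, then it intertwines `f(T)` and `f(S)`. -/
theorem holoCalc_intertwine {X Y : Type*} [NormedAddCommGroup X] [NormedSpace ℂ X]
    [CompleteSpace X] [NormedAddCommGroup Y] [NormedSpace ℂ Y] [CompleteSpace Y]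
    (hU : IsOpen U) (hDU : Metric.closedBall (0 : ℂ) 1 ⊆ U) (hf : DifferentiableOn ℂ f U)
    {T : X →L[ℂ] X} (hT : ‖T‖ ≤ 1) {S : Y →L[ℂ] Y} (hS : ‖S‖ ≤ 1) (q : X →L[ℂ] Y)
    (h : ∀ x, q (T x) = S (q x)) (x : X) : q (holoCalc f T x) = holoCalc f S (q x) := by
  have hpow : ∀ n : ℕ, ∀ x, q ((T ^ n) x) = (S ^ n) (q x) := by
    intro n
    induction n with
    | zero => intro x; rfl
    | succ k ih => intro x; rw [pow_succ, pow_succ]; exact (ih _).trans (congrArg (S ^ k) (h x))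
  have h1 := ((hasSum_holoCalc hU hDU hf hT).mapL (ContinuousLinearMap.apply ℂ X x)).mapL q
  have h2 := (hasSum_holoCalc hU hDU hf hS).mapL (ContinuousLinearMap.apply ℂ Y (q x))
  refine h1.unique (h2.congr_fun fun n => ?_)
  simp only [ContinuousLinearMap.apply_apply, map_smul, hpow]

theorem holoCalc_smul_one {Y : Type*} [NormedAddCommGroup Y] [NormedSpace ℂ Y] [CompleteSpace Y]
    (hU : IsOpen U) (hDU : Metric.closedBall (0 : ℂ) 1 ⊆ U) (hf : DifferentiableOn ℂ f U)
    {w : ℂ} (hw : ‖w‖ ≤ 1) :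
    holoCalc f (w • (1 : Y →L[ℂ] Y)) = f w • (1 : Y →L[ℂ] Y) := by
  have h := (hasSum_taylor_of_mem_closedBall hU hDU hf (mem_closedBall_zero_iff.2 hw)).smul_const
    (1 : Y →L[ℂ] Y)
  rw [← h.tsum_eq]
  simp only [holoCalc, smul_pow, one_pow, smul_smul]

end TaylorSeries

/-! ### Unilateral and bilateral shifts -/

section Reindex

variable {ι κ : Type*}

/-- Composition with a map of index sets, on bounded sequences. -/
noncomputable def reindexLInf (g : ι → κ) :
    lp (fun _ : κ => ℂ) ∞ →L[ℂ] lp (fun _ : ι => ℂ) ∞ :=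
  LinearMap.mkContinuous
    { toFun := fun x => ⟨fun i => x (g i), memℓp_infty ⟨‖x‖, by
        rintro _ ⟨n, rfl⟩
        exact lp.norm_apply_le_norm ENNReal.top_ne_zero x (g n)⟩⟩
      map_add' := fun _ _ => rfl
      map_smul' := fun _ _ => rfl }
    1
    (fun x => by
      rw [one_mul]
      exact lp.norm_le_of_forall_le (norm_nonneg x)
        (fun n => lp.norm_apply_le_norm ENNReal.top_ne_zero x (g n)))

theorem norm_reindexLInf_le (g : ι → κ) : ‖reindexLInf g‖ ≤ 1 :=
  LinearMap.mkContinuous_norm_le _ zero_le_one _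

theorem norm_backwardShift_le : ‖backwardShift‖ ≤ 1 :=
  LinearMap.mkContinuous_norm_le _ zero_le_one _

/-- The shift `(xₖ) ↦ (xₖ₊₁)` on bounded sequences indexed by the integers. -/
noncomputable def bilateralShift : (lp (fun _ : ℤ => ℂ) ∞ →L[ℂ] lp (fun _ : ℤ => ℂ) ∞)ˣ where
  val := reindexLInf (· + 1)
  inv := reindexLInf (· - 1)
  val_inv := by
    ext x k
    exact congrArg (x : ℤ → ℂ) (add_sub_cancel_right k 1)
  inv_val := by
    ext x k
    exact congrArg (x : ℤ → ℂ) (sub_add_cancel k 1)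

theorem norm_bilateralShift_le :
    ‖(bilateralShift : lp (fun _ : ℤ => ℂ) ∞ →L[ℂ] lp (fun _ : ℤ => ℂ) ∞)‖ ≤ 1 :=
  norm_reindexLInf_le _

theorem norm_bilateralShift_inv_le :
    ‖((bilateralShift⁻¹ : (lp (fun _ : ℤ => ℂ) ∞ →L[ℂ] lp (fun _ : ℤ => ℂ) ∞)ˣ) :
      lp (fun _ : ℤ => ℂ) ∞ →L[ℂ] lp (fun _ : ℤ => ℂ) ∞)‖ ≤ 1 :=
  norm_reindexLInf_le _

theorem norm_le_one_of_mem_spectrum {X : Type*} [NormedAddCommGroup X] [NormedSpace ℂ X]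
    [CompleteSpace X] {T : X →L[ℂ] X} (hT : ‖T‖ ≤ 1) {w : ℂ} (hw : w ∈ spectrum ℂ T) :
    ‖w‖ ≤ 1 :=
  (spectrum.norm_le_norm_mul_of_mem hw).trans
    (mul_le_one₀ hT (norm_nonneg _) ContinuousLinearMap.norm_id_le)

/-- The shift and its inverse are both contractions, which bounds `w` and `w⁻¹`. -/
theorem norm_eq_one_of_mem_spectrum_bilateralShift {w : ℂ}
    (hw : w ∈ spectrum ℂ (bilateralShift : lp (fun _ : ℤ => ℂ) ∞ →L[ℂ] lp (fun _ : ℤ => ℂ) ∞)) :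
    ‖w‖ = 1 := by
  have hw0 : w ≠ 0 := spectrum.ne_zero_of_mem_of_unit hw
  have h1 := norm_le_one_of_mem_spectrum norm_bilateralShift_le hw
  have h2 := norm_le_one_of_mem_spectrum norm_bilateralShift_inv_le
    ((spectrum.inv_mem_iff (r := Units.mk0 w hw0)).1 hw)
  simp only [Units.val_inv_eq_inv_val, Units.val_mk0, norm_inv] at h2
  exact le_antisymm h1 ((inv_le_one₀ (norm_pos_iff.2 hw0)).1 h2)

end Reindex

/-! ### Geometric sequences as eigenvectors and as obstructions -/

section PowerSequence

/-- The bounded sequence `(wⁿ)`, for `w` in the closed unit disc. -/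
def powSeq (w : ℂ) (hw : ‖w‖ ≤ 1) : LInf :=
  ⟨fun n => w ^ n, memℓp_infty ⟨1, by
    rintro _ ⟨n, rfl⟩
    simpa only [norm_pow] using pow_le_one₀ (norm_nonneg w) hw⟩⟩

theorem backwardShift_powSeq {w : ℂ} (hw : ‖w‖ ≤ 1) :
    backwardShift (powSeq w hw) = w • powSeq w hw := by
  ext n
  exact pow_succ' w n

theorem powSeq_ne_zero {w : ℂ} (hw : ‖w‖ ≤ 1) : powSeq w hw ≠ 0 := by
  intro h
  have : powSeq w hw 0 = (0 : LInf) 0 := by rw [h]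
  exact one_ne_zero ((pow_zero w).symm.trans this)

theorem holoCalc_powSeq {f : ℂ → ℂ} {U : Set ℂ} (hU : IsOpen U)
    (hDU : Metric.closedBall (0 : ℂ) 1 ⊆ U) (hf : DifferentiableOn ℂ f U)
    {w : ℂ} (hw : ‖w‖ ≤ 1) :
    holoCalc f backwardShift (powSeq w hw) = f w • powSeq w hw := by
  have hw' : ‖w • (1 : ℂ →L[ℂ] ℂ)‖ ≤ 1 := by simpa [norm_smul] using hw
  have h := holoCalc_intertwine hU hDU hf hw' norm_backwardShift_le
    (ContinuousLinearMap.toSpanSingleton ℂ (powSeq w hw)) (fun t => by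
      simp [backwardShift_powSeq, smul_smul, mul_comm]) 1
  rw [holoCalc_smul_one hU hDU hf hw] at h
  simpa using h.symm

/-- For `|w| = 1`, the sequence `(wⁿ)` is at positive distance from the range of `B - w`. -/
theorem half_le_norm_sub_powSeq {w : ℂ} (hw : ‖w‖ = 1) (x : LInf) :
    1 / 2 ≤ ‖(backwardShift x - w • x) - w • powSeq w hw.le‖ := by
  by_contra! hlt
  have hstep : ∀ n : ℕ, ‖x (n + 1) - w * x n - w ^ (n + 1)‖ ≤ 1 / 2 := by
    intro n
    refine le_trans ?_ hlt.le
    have := lp.norm_apply_le_norm ENNReal.top_ne_zero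
      ((backwardShift x - w • x) - w • powSeq w hw.le) n
    rw [pow_succ']
    exact this
  -- Iterating the recursion adds `w ^ N` once per step, in resonance, while the errors add up to at
  -- most half of that; so `x` would grow linearly.
  have hN : ∀ N : ℕ, ‖x N - w ^ N * x 0 - N * w ^ N‖ ≤ N / 2 := by
    intro N
    induction N with
    | zero => simp
    | succ n ih =>
      have e : x (n + 1) - w ^ (n + 1) * x 0 - ((n + 1 : ℕ) : ℂ) * w ^ (n + 1) =
          w * (x n - w ^ n * x 0 - n * w ^ n) + (x (n + 1) - w * x n - w ^ (n + 1)) := by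
        push_cast
        ring
      rw [e]
      refine (norm_add_le _ _).trans ?_
      rw [norm_mul, hw, one_mul]
      push_cast
      linarith [hstep n]
  obtain ⟨N, hNlt⟩ := exists_nat_gt (4 * ‖x‖)
  have h1 := hN N
  have h2 : ‖(N : ℂ) * w ^ N‖ = N := by simp [hw]
  have h3 : ‖w ^ N * x 0‖ ≤ ‖x‖ := by
    simpa [hw] using lp.norm_apply_le_norm ENNReal.top_ne_zero x 0
  have h4 : ‖x N‖ ≤ ‖x‖ := lp.norm_apply_le_norm ENNReal.top_ne_zero x N
  have h5 := norm_sub_norm_le ((N : ℂ) * w ^ N) (x N - w ^ N * x 0)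
  have h6 := norm_sub_le (x N) (w ^ N * x 0)
  rw [norm_sub_rev ((N : ℂ) * w ^ N)] at h5
  linarith

end PowerSequence

/-! ### Criteria for and against `J`-class -/

section JClass

variable {X : Type*} [NormedAddCommGroup X] [NormedSpace ℂ X]

/-- A `J`-class operator has no nonzero quotient which is a scalar in the closed unit disc. -/
theorem IsJClass.one_lt_norm_of_intertwine {T : X →L[ℂ] X} (hT : IsJClass T) {Y : Type*}
    [NormedAddCommGroup Y] [NormedSpace ℂ Y] {q : X →L[ℂ] Y} (hq : q ≠ 0) {μ : ℂ}
    (h : ∀ x, q (T x) = μ • q x) : 1 < ‖μ‖ := by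
  by_contra! hμ
  obtain ⟨x, -, hx⟩ := hT
  have hpow : ∀ (k : ℕ) (v : X), q ((T ^ k) v) = μ ^ k • q v := by
    intro k
    induction k with
    | zero => intro v; simp
    | succ k ih => intro v; rw [pow_succ, pow_succ, mul_smul, ← h]; exact ih _
  -- Powers of `μ` do not expand, so `q` would be bounded on all of `X`.
  have hbound : ∀ y, ‖q y‖ ≤ ‖q x‖ := by
    intro y
    obtain ⟨k, u, -, hu, hy⟩ : y ∈ JSet T x := hx ▸ Set.mem_univ y
    refine le_of_tendsto_of_tendsto (((q.continuous.tendsto y).comp hy).norm)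
      (((q.continuous.tendsto x).comp hu).norm) (Filter.Eventually.of_forall fun n => ?_)
    simp only [Function.comp_apply, hpow, norm_smul, norm_pow]
    exact mul_le_of_le_one_left (norm_nonneg _) (pow_le_one₀ (norm_nonneg _) hμ)
  obtain ⟨y, hy⟩ := DFunLike.ne_iff.1 hq
  have hy : 0 < ‖q y‖ := norm_pos_iff.2 hy
  obtain ⟨N, hN⟩ := exists_nat_gt (‖q x‖ / ‖q y‖)
  have := hbound ((N : ℂ) • y)
  rw [map_smul, norm_smul, Complex.norm_natCast] at this
  rw [div_lt_iff₀ hy] at hN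
  linarith

theorem tendsto_clm_apply {ι Y : Type*} [NormedAddCommGroup Y] [NormedSpace ℂ Y] {l : Filter ι}
    {A : ι → X →L[ℂ] Y} {A₀ : X →L[ℂ] Y} {v : ι → X} {v₀ : X} (hA : Filter.Tendsto A l (nhds A₀))
    (hv : Filter.Tendsto v l (nhds v₀)) :
    Filter.Tendsto (fun i => A i (v i)) l (nhds (A₀ v₀)) :=
  (isBoundedBilinearMap_apply.continuous.tendsto (A₀, v₀)).comp (hA.prodMk_nhds hv)

/-- Applying the inverse powers to a convergent sequence `T ^ k n (v n)` recovers `v n` and sends it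
to zero, so only `x = 0` has a nonempty `J`-set. -/
theorem not_isJClass_of_inv_pow_tendsto_zero (u : (X →L[ℂ] X)ˣ)
    (hu : Filter.Tendsto (fun n : ℕ => ((u⁻¹ : (X →L[ℂ] X)ˣ) : X →L[ℂ] X) ^ n)
      Filter.atTop (nhds 0)) : ¬ IsJClass (u : X →L[ℂ] X) := by
  rintro ⟨x, hx0, hx⟩
  obtain ⟨k, v, hk, hv, hy⟩ : (0 : X) ∈ JSet (u : X →L[ℂ] X) x := hx ▸ Set.mem_univ _
  refine hx0 (tendsto_nhds_unique hv ?_)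
  have h := tendsto_clm_apply (hu.comp hk.tendsto_atTop) hy
  rw [map_zero] at h
  refine h.congr fun n => ?_
  change (((u⁻¹ : (X →L[ℂ] X)ˣ) : X →L[ℂ] X) ^ k n * (u : X →L[ℂ] X) ^ k n) (v n) = v n
  rw [← Units.val_pow_eq_pow_val, ← Units.val_pow_eq_pow_val, inv_pow, Units.inv_mul]
  rfl

/-- An operator with a nonzero kernel, and right inverses of its powers which tend strongly to
zero, is `J`-class. -/
theorem isJClass_of_rightInverse {T : X →L[ℂ] X} {x : X} (hx0 : x ≠ 0) (hx : T x = 0)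
    (S : ℕ → X → X) (hS : ∀ y, Filter.Tendsto (fun n => S n y) Filter.atTop (nhds 0))
    (hTS : ∀ n y, (T ^ n) (S n y) = y) : IsJClass T := by
  refine ⟨x, hx0, Set.eq_univ_of_forall fun y => ?_⟩
  -- Exponents start at 1 because `T ^ 0` does not kill `x`.
  refine ⟨fun n => n + 1, fun n => x + S (n + 1) y, fun a b hab => Nat.succ_lt_succ hab, ?_, ?_⟩
  · simpa using tendsto_const_nhds.add ((hS y).comp (Filter.tendsto_add_atTop_nat 1))
  · refine tendsto_const_nhds.congr fun n => ?_
    rw [map_add, hTS, pow_succ]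
    change y = (T ^ n) (T x) + y
    rw [hx, map_zero, zero_add]

end JClass

/-! ### The two implications for `f(B)` -/

section Main

variable {f : ℂ → ℂ} {U : Set ℂ}

theorem one_lt_norm_of_isJClass (hU : IsOpen U)
    (hDU : Metric.closedBall (0 : ℂ) 1 ⊆ U) (hf : DifferentiableOn ℂ f U)
    (hJ : IsJClass (holoCalc f backwardShift)) {w : ℂ} (hw : ‖w‖ = 1) : 1 < ‖f w‖ := by
  let M : Submodule ℂ LInf :=
    (LinearMap.range ((backwardShift - w • (1 : LInf →L[ℂ] LInf) : LInf →L[ℂ] LInf) :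
      LInf →ₗ[ℂ] LInf)).topologicalClosure
  have : IsClosed (M : Set LInf) := Submodule.isClosed_topologicalClosure _
  have hsmul : ‖w • (1 : (LInf ⧸ M) →L[ℂ] (LInf ⧸ M))‖ ≤ 1 := by
    refine ContinuousLinearMap.opNorm_le_bound _ zero_le_one fun x => ?_
    change ‖w • x‖ ≤ _
    rw [norm_smul, hw]
  refine hJ.one_lt_norm_of_intertwine (q := M.mkQL) ?_ fun x => ?_
  · intro h0
    have hM : w • powSeq w hw.le ∈ M :=
      (Submodule.Quotient.mk_eq_zero M).1 (DFunLike.congr_fun h0 _)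
    obtain ⟨y, ⟨x, rfl⟩, hy⟩ := Metric.mem_closure_iff.1 hM (1 / 2) (by norm_num)
    rw [dist_comm, dist_eq_norm] at hy
    exact absurd (half_le_norm_sub_powSeq hw x) (not_le.2 hy)
  · have h := holoCalc_intertwine hU hDU hf norm_backwardShift_le hsmul M.mkQL (fun x => by
      refine (Submodule.Quotient.eq M).2 ?_
      exact Submodule.le_topologicalClosure _ ⟨x, rfl⟩) x
    rw [holoCalc_smul_one hU hDU hf hw.le] at h
    exact h

theorem isJClass_holoCalc_backwardShift (hU : IsOpen U)
    (hDU : Metric.closedBall (0 : ℂ) 1 ⊆ U) (hf : DifferentiableOn ℂ f U)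
    (h1 : ∀ w : ℂ, ‖w‖ = 1 → 1 < ‖f w‖) {w : ℂ} (hw : ‖w‖ ≤ 1) (hfw : f w = 0) :
    IsJClass (holoCalc f backwardShift) := by
  obtain ⟨u, hu, hlim⟩ := exists_unit_holoCalc hU hDU hf
    (T := (bilateralShift : lp (fun _ : ℤ => ℂ) ∞ →L[ℂ] lp (fun _ : ℤ => ℂ) ∞))
    norm_bilateralShift_le fun w hw => h1 w (norm_eq_one_of_mem_spectrum_bilateralShift hw)
  let P : lp (fun _ : ℤ => ℂ) ∞ →L[ℂ] LInf := reindexLInf (fun n : ℕ => (n : ℤ))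
  -- Extends a sequence to negative indices by its entry at 0; only `P ∘ E = id` and boundedness
  -- matter.
  let E : LInf →L[ℂ] lp (fun _ : ℤ => ℂ) ∞ := reindexLInf Int.toNat
  have hPu : ∀ x, P ((u : lp (fun _ : ℤ => ℂ) ∞ →L[ℂ] lp (fun _ : ℤ => ℂ) ∞) x) =
      holoCalc f backwardShift (P x) := by
    intro x
    rw [hu]
    refine holoCalc_intertwine hU hDU hf norm_bilateralShift_le norm_backwardShift_le P
      (fun x => ?_) x
    ext n
    exact congrArg (x : ℤ → ℂ) (Nat.cast_succ n).symm
  have hPpow : ∀ (n : ℕ) x,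
      P (((u : lp (fun _ : ℤ => ℂ) ∞ →L[ℂ] lp (fun _ : ℤ => ℂ) ∞) ^ n) x) =
        (holoCalc f backwardShift ^ n) (P x) := by
    intro n
    induction n with
    | zero => intro x; rfl
    | succ n ih =>
      intro x
      rw [pow_succ, pow_succ]
      exact (ih _).trans (congrArg (holoCalc f backwardShift ^ n) (hPu x))
  refine isJClass_of_rightInverse (powSeq_ne_zero hw)
    (by rw [holoCalc_powSeq hU hDU hf, hfw, zero_smul])
    (fun n y => P ((((u⁻¹ : (lp (fun _ : ℤ => ℂ) ∞ →L[ℂ] lp (fun _ : ℤ => ℂ) ∞)ˣ) :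
      lp (fun _ : ℤ => ℂ) ∞ →L[ℂ] lp (fun _ : ℤ => ℂ) ∞) ^ n) (E y))) (fun y => ?_) fun n y => ?_
  · have h := (P.continuous.tendsto _).comp (tendsto_clm_apply hlim (tendsto_const_nhds (x := E y)))
    rw [zero_apply, map_zero] at h
    exact h
  · rw [← hPpow]
    change P (((u : lp (fun _ : ℤ => ℂ) ∞ →L[ℂ] lp (fun _ : ℤ => ℂ) ∞) ^ n *
      ((u⁻¹ : (lp (fun _ : ℤ => ℂ) ∞ →L[ℂ] lp (fun _ : ℤ => ℂ) ∞)ˣ) :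
        lp (fun _ : ℤ => ℂ) ∞ →L[ℂ] lp (fun _ : ℤ => ℂ) ∞) ^ n) (E y)) = y
    rw [← Units.val_pow_eq_pow_val, ← Units.val_pow_eq_pow_val, inv_pow, Units.mul_inv]
    ext n
    exact congrArg (y : ℕ → ℂ) (Int.toNat_natCast n)

/-- If `f` maps the unit circle outside the closed unit disc, then the image of the open disc
contains the closed unit disc as soon as it meets it. -/
theorem closedBall_subset_image_ball (hU : IsOpen U)
    (hDU : Metric.closedBall (0 : ℂ) 1 ⊆ U) (hf : DifferentiableOn ℂ f U)
    (h1 : ∀ w : ℂ, ‖w‖ = 1 → 1 < ‖f w‖) {w : ℂ} (hw : ‖w‖ ≤ 1) (hfw : ‖f w‖ ≤ 1) :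
    Metric.closedBall (0 : ℂ) 1 ⊆ f '' Metric.ball (0 : ℂ) 1 := by
  obtain ⟨r, hr, hsub⟩ := exists_ball_subset_of_closedBall_subset hU hDU
  have hlt : Metric.closedBall (0 : ℂ) 1 ⊆ Metric.ball 0 r := Metric.closedBall_subset_ball hr
  have han : AnalyticOnNhd ℂ f (Metric.ball 0 r) :=
    (hf.mono hsub).analyticOnNhd Metric.isOpen_ball
  have hopen : IsOpen (f '' Metric.ball (0 : ℂ) 1) := by
    rcases han.is_constant_or_isOpen (convex_ball 0 r).isPreconnected with ⟨c, hc⟩ | h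
    · have e1 := hc w (hlt (mem_closedBall_zero_iff.2 hw))
      have e2 := hc 1 (hlt (by simp))
      have := h1 1 (by simp)
      rw [e2, ← e1] at this
      exact absurd hfw (not_le.2 this)
    · exact h _ (Metric.ball_subset_closedBall.trans hlt) Metric.isOpen_ball
  have hcomp : IsCompact (f '' Metric.closedBall (0 : ℂ) 1) :=
    (isCompact_closedBall 0 1).image_of_continuousOn (hf.continuousOn.mono hDU)
  have hball : ∀ z : ℂ, ‖z‖ ≤ 1 → ‖f z‖ ≤ 1 → z ∈ Metric.ball (0 : ℂ) 1 := fun z hz hfz =>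
    mem_ball_zero_iff.2 (hz.lt_of_ne fun h => (h1 z h).not_ge hfz)
  -- No value on the circle lies in the closed disc, so the open image of the disc and the
  -- complement of the compact image of its closure separate it.
  refine (convex_closedBall (0 : ℂ) 1).isPreconnected.subset_left_of_subset_union hopen
    hcomp.isClosed.isOpen_compl
    (Set.disjoint_compl_right_iff_subset.2 (Set.image_mono Metric.ball_subset_closedBall)) ?_
    ⟨f w, mem_closedBall_zero_iff.2 hfw, w, hball w hw hfw, rfl⟩
  intro y hy
  by_cases hyf : y ∈ f '' Metric.closedBall (0 : ℂ) 1
  · obtain ⟨z, hz, rfl⟩ := hyf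
    exact Or.inl ⟨z, hball z (mem_closedBall_zero_iff.1 hz) (mem_closedBall_zero_iff.1 hy), rfl⟩
  · exact Or.inr hyf

end Main

theorem corollary3p12 (f : ℂ → ℂ) (U : Set ℂ) (hU : IsOpen U)
    (hDU : Metric.closedBall (0 : ℂ) 1 ⊆ U) (hf : DifferentiableOn ℂ f U) :
    IsJClass (holoCalc f backwardShift) ↔
      f '' Metric.sphere (0 : ℂ) 1 ∩ Metric.closedBall (0 : ℂ) 1 = ∅ ∧
        Metric.closedBall (0 : ℂ) 1 ⊆ f '' Metric.ball (0 : ℂ) 1 := by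
  constructor
  · intro hJ
    have h1 : ∀ w : ℂ, ‖w‖ = 1 → 1 < ‖f w‖ := fun w hw => one_lt_norm_of_isJClass hU hDU hf hJ hw
    refine ⟨?_, ?_⟩
    · rw [Set.eq_empty_iff_forall_notMem]
      rintro _ ⟨⟨w, hw, rfl⟩, hfw⟩
      exact (h1 w (mem_sphere_zero_iff_norm.1 hw)).not_ge (mem_closedBall_zero_iff.1 hfw)
    · by_contra hsub
      obtain ⟨u, hu, hlim⟩ := exists_unit_holoCalc hU hDU hf norm_backwardShift_le fun w hw => by
        by_contra! hfw
        exact hsub (closedBall_subset_image_ball hU hDU hf h1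
          (norm_le_one_of_mem_spectrum norm_backwardShift_le hw) hfw)
      exact not_isJClass_of_inv_pow_tendsto_zero u hlim (hu ▸ hJ)
  · rintro ⟨h1, h2⟩
    obtain ⟨w, hw, hfw⟩ := h2 (Metric.mem_closedBall_self zero_le_one)
    refine isJClass_holoCalc_backwardShift hU hDU hf (fun z hz => ?_)
      (mem_ball_zero_iff.1 hw).le hfw
    by_contra! hfz
    have : f z ∈ f '' Metric.sphere (0 : ℂ) 1 ∩ Metric.closedBall (0 : ℂ) 1 :=
      ⟨⟨z, mem_sphere_zero_iff_norm.2 hz, rfl⟩, mem_closedBall_zero_iff.2 hfz⟩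
    rw [h1] at this
    exact this
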